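/- Let $\alpha,\beta\in\mathbb R$. On $\mathbb R^4$, write $x=(x_1,x_2,x_3,x_4)$ as $x_1 1+x_2 i+x_3 j+x_4\,ij$ and let $\cdot$ be the bilinear product determined by $i^2=-\alpha$, $j^2=-\beta$, $ij=ji$ (so $(ij)^2=\alpha\beta$), with unit $1$. Let $$M_{t_j}=\{x\in\mathbb R^4 : x_1x_2+\beta x_3x_4=0,\ \ x_1^2-\alpha x_2^2+\beta x_3^2-\alpha\beta x_4^2\neq 0\}.$$ Then $M_{t_j}$ is a $3$-dimensional embedded smooth submanifold of $\mathbb R^4$ and, with the product $\cdot$, a Lie group. Its Lie algebra, i.e. the space of smooth left-invariant vector fields on $M_{t_j}$, is the real span of the left-invariant vector fields $X_1,X_3,X_4$ whose components in $\mathbb R^4$ at the point $x\in M_{t_j}$ are $$X_1=x=(x_1,x_2,x_3,x_4),\qquad X_3=x\cdot j=(-\beta x_3,-\beta x_4,x_1,x_2),\qquad X_4=x\cdot ij=(\alpha\beta x_4,-\beta x_3,-\alpha x_2,x_1).$$ Equivalently, the values of $X_1,X_3,X_4$ at the identity span the tangent space of $M_{t_j}$ at the identity. -/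

import Mathlib

open scoped Manifold ContDiff Topology

/-- The generalized bicomplex product on `ℝ⁴`, a vector `x` standing for
`x 0 + x 1 * i + x 2 * j + x 3 * ij`, where `i² = -α`, `j² = -β`, `ij = ji`. -/
def gbMul (α β : ℝ) (x y : Fin 4 → ℝ) : Fin 4 → ℝ :=
  ![x 0 * y 0 - α * x 1 * y 1 - β * x 2 * y 2 + α * β * x 3 * y 3,
    x 0 * y 1 + x 1 * y 0 - β * x 2 * y 3 - β * x 3 * y 2,
    x 0 * y 2 + x 2 * y 0 - α * x 1 * y 3 - α * x 3 * y 1,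
    x 0 * y 3 + x 3 * y 0 + x 1 * y 2 + x 2 * y 1]

/-- The basis element `1`. -/
def gbOne : Fin 4 → ℝ := ![1, 0, 0, 0]

/-- The basis element `j`. -/
def gbJ : Fin 4 → ℝ := ![0, 0, 1, 0]

/-- The basis element `ij`. -/
def gbIJ : Fin 4 → ℝ := ![0, 0, 0, 1]

/-- The conjugation with respect to `j`: `(z + w j) ↦ (z - w j)` for `z, w` in the span
of `1, i`. -/
def gbConjJ (x : Fin 4 → ℝ) : Fin 4 → ℝ := ![x 0, x 1, -x 2, -x 3]

/-- The quadratic form `g(x, x)` of the metric `dx₁² - α dx₂² + β dx₃² - αβ dx₄²`. -/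
def gbMetricJ (α β : ℝ) (x : Fin 4 → ℝ) : ℝ :=
  x 0 ^ 2 - α * x 1 ^ 2 + β * x 2 ^ 2 - α * β * x 3 ^ 2

/-- The hyperquadric `M` with respect to the conjugation in `j`. -/
def hyperquadricJ (α β : ℝ) : Set (Fin 4 → ℝ) :=
  {x | x 0 * x 1 + β * x 2 * x 3 = 0 ∧ gbMetricJ α β x ≠ 0}

theorem gbMul_mem_hyperquadricJ {α β : ℝ} {x y : Fin 4 → ℝ}
    (hx : x ∈ hyperquadricJ α β) (hy : y ∈ hyperquadricJ α β) :
    gbMul α β x y ∈ hyperquadricJ α β := by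
  obtain ⟨hx1, hx2⟩ := hx
  obtain ⟨hy1, hy2⟩ := hy
  have key : gbMetricJ α β (gbMul α β x y) = gbMetricJ α β x * gbMetricJ α β y := by
    simp only [gbMetricJ, gbMul, Matrix.cons_val]
    linear_combination (-4 * α * (y 0 * y 1 + β * y 2 * y 3)) * hx1
  refine ⟨?_, by rw [key]; exact mul_ne_zero hx2 hy2⟩
  simp only [gbMul, Matrix.cons_val]
  simp only [gbMetricJ] at *
  linear_combination (y 0 ^ 2 - α * y 1 ^ 2 + β * y 2 ^ 2 - α * β * y 3 ^ 2) * hx1 +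
    (x 0 ^ 2 - α * x 1 ^ 2 + β * x 2 ^ 2 - α * β * x 3 ^ 2) * hy1

theorem gbInv_mem_hyperquadricJ {α β : ℝ} {x : Fin 4 → ℝ} (hx : x ∈ hyperquadricJ α β) :
    (gbMetricJ α β x)⁻¹ • gbConjJ x ∈ hyperquadricJ α β := by
  obtain ⟨hx1, hx2⟩ := hx
  have key : gbMetricJ α β ((gbMetricJ α β x)⁻¹ • gbConjJ x) = (gbMetricJ α β x)⁻¹ := by
    have : gbMetricJ α β ((gbMetricJ α β x)⁻¹ • gbConjJ x) =
        (gbMetricJ α β x)⁻¹ ^ 2 * gbMetricJ α β x := by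
      generalize (gbMetricJ α β x)⁻¹ = c
      simp only [gbMetricJ, gbConjJ, Pi.smul_apply, smul_eq_mul, Matrix.cons_val]
      ring
    rw [this]
    field_simp
  refine ⟨?_, by rw [key]; exact inv_ne_zero hx2⟩
  generalize (gbMetricJ α β x)⁻¹ = c
  simp only [gbConjJ, Pi.smul_apply, smul_eq_mul, Matrix.cons_val]
  linear_combination c ^ 2 * hx1

/-- The group structure of the hyperquadric under the generalized bicomplex product. -/
noncomputable instance hyperquadricJGroup (α β : ℝ) : Group (hyperquadricJ α β) where
  mul x y := ⟨gbMul α β x y, gbMul_mem_hyperquadricJ x.2 y.2⟩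
  one := ⟨gbOne, by simp [hyperquadricJ, gbMetricJ, gbOne]⟩
  inv x := ⟨(gbMetricJ α β x)⁻¹ • gbConjJ x, gbInv_mem_hyperquadricJ x.2⟩
  mul_assoc x y z := by
    apply Subtype.ext
    change gbMul α β (gbMul α β x y) z = gbMul α β x (gbMul α β y z)
    ext k
    fin_cases k <;> simp only [gbMul, Matrix.cons_val, Fin.reduceFinMk, Fin.zero_eta, Fin.mk_one] <;>
      ring
  one_mul x := by
    apply Subtype.ext
    change gbMul α β gbOne x = x
    ext k
    fin_cases k <;> simp [gbMul, gbOne]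
  mul_one x := by
    apply Subtype.ext
    change gbMul α β x gbOne = x
    ext k
    fin_cases k <;> simp [gbMul, gbOne]
  inv_mul_cancel x := by
    apply Subtype.ext
    change gbMul α β ((gbMetricJ α β x)⁻¹ • gbConjJ x) x = gbOne
    obtain ⟨x, hx1, hx2⟩ := x
    have hc : (gbMetricJ α β x)⁻¹ * gbMetricJ α β x = 1 := inv_mul_cancel₀ hx2
    simp only
    revert hc
    generalize (gbMetricJ α β x)⁻¹ = c
    intro hc
    simp only [gbMetricJ] at hc
    ext k
    fin_cases k <;>
      simp only [gbMul, gbOne, gbConjJ, Pi.smul_apply, smul_eq_mul, Matrix.cons_val,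
        Fin.reduceFinMk, Fin.zero_eta, Fin.mk_one]
    · linear_combination hc
    · linear_combination 2 * c * hx1
    · ring
    · ring

theorem hyperquadricJ_coe_mul {α β : ℝ} (x y : hyperquadricJ α β) :
    ((x * y : hyperquadricJ α β) : Fin 4 → ℝ) = gbMul α β x y := rfl

theorem hyperquadricJ_coe_one {α β : ℝ} :
    ((1 : hyperquadricJ α β) : Fin 4 → ℝ) = gbOne := rfl

theorem contDiff_gbMul_left (α β : ℝ) (a : Fin 4 → ℝ) : ContDiff ℝ ∞ (gbMul α β a) := by
  rw [contDiff_pi]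
  intro k
  fin_cases k <;> simp only [gbMul, Matrix.cons_val, Fin.reduceFinMk, Fin.zero_eta, Fin.mk_one] <;>
    fun_prop

/-- The coordinates `x₁, x₃, x₄`. -/
def gbProj (x : Fin 4 → ℝ) : Fin 3 → ℝ := ![x 0, x 2, x 3]

/-- The point of the quadric `x₁ x₂ + β x₃ x₄ = 0` with given coordinates `x₁ ≠ 0, x₃, x₄`. -/
noncomputable def gbGraph (β : ℝ) (u : Fin 3 → ℝ) : Fin 4 → ℝ :=
  ![u 0, -(β * u 1 * u 2) / u 0, u 1, u 2]

/-- The coordinates `(x₁, x₃, x₄)` of the points of the hyperquadric with `x₁ ≠ 0`. -/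
def gbChartTarget (α β : ℝ) : Set (Fin 3 → ℝ) :=
  {u | u 0 ≠ 0 ∧ gbMetricJ α β (gbGraph β u) ≠ 0}

theorem gbGraph_mem {α β : ℝ} {u : Fin 3 → ℝ} (hu : u ∈ gbChartTarget α β) :
    gbGraph β u ∈ hyperquadricJ α β := by
  obtain ⟨h0, h1⟩ := hu
  refine ⟨?_, h1⟩
  simp only [gbGraph, Matrix.cons_val]
  field_simp
  ring

theorem gbProj_gbGraph (β : ℝ) (u : Fin 3 → ℝ) : gbProj (gbGraph β u) = u := by
  ext k
  fin_cases k <;> simp [gbProj, gbGraph]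

theorem gbGraph_gbProj {α β : ℝ} {x : Fin 4 → ℝ} (hx : x ∈ hyperquadricJ α β) (h0 : x 0 ≠ 0) :
    gbGraph β (gbProj x) = x := by
  have h1 := hx.1
  ext k
  fin_cases k <;> simp only [gbProj, gbGraph, Matrix.cons_val, Fin.reduceFinMk, Fin.zero_eta,
    Fin.mk_one]
  field_simp
  linear_combination -h1

theorem contDiff_gbProj : ContDiff ℝ ∞ gbProj := by
  rw [contDiff_pi]
  intro k
  fin_cases k <;> simp only [gbProj, Matrix.cons_val, Fin.reduceFinMk, Fin.zero_eta,
    Fin.mk_one] <;> fun_prop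

theorem contDiffOn_gbGraph (β : ℝ) : ContDiffOn ℝ ∞ (gbGraph β) {u | u 0 ≠ 0} := by
  rw [contDiffOn_pi]
  intro k
  fin_cases k <;> simp only [gbGraph, Matrix.cons_val, Fin.reduceFinMk, Fin.zero_eta, Fin.mk_one]
  · fun_prop
  · exact ContDiffOn.div (by fun_prop) (by fun_prop) (fun u hu => hu)
  · fun_prop
  · fun_prop

theorem isOpen_gbChartTarget (α β : ℝ) : IsOpen (gbChartTarget α β) := by
  have ho : IsOpen {u : Fin 3 → ℝ | u 0 ≠ 0} := isOpen_ne_fun (by fun_prop) (by fun_prop)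
  have hg : Continuous (gbMetricJ α β) := by unfold gbMetricJ; fun_prop
  have hc : ContinuousOn (fun u => gbMetricJ α β (gbGraph β u)) {u | u 0 ≠ 0} :=
    hg.comp_continuousOn (contDiffOn_gbGraph β).continuousOn
  exact hc.isOpen_inter_preimage ho (isOpen_ne (x := (0 : ℝ)))

open Classical in
/-- The chart at `a`: the coordinates `(y₁, y₃, y₄)` of the left translate `y = a⁻¹ x`,
defined where `y₁ ≠ 0`. -/
noncomputable def gbChart (α β : ℝ) (a : hyperquadricJ α β) :
    OpenPartialHomeomorph (hyperquadricJ α β) (Fin 3 → ℝ) where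
  toFun x := gbProj (a⁻¹ * x : hyperquadricJ α β)
  invFun u := if hu : u ∈ gbChartTarget α β then a * ⟨gbGraph β u, gbGraph_mem hu⟩ else a
  source := {x | (a⁻¹ * x : hyperquadricJ α β).1 0 ≠ 0}
  target := gbChartTarget α β
  map_source' x hx := by
    refine ⟨hx, ?_⟩
    rw [gbGraph_gbProj (a⁻¹ * x : hyperquadricJ α β).2 hx]
    exact (a⁻¹ * x : hyperquadricJ α β).2.2
  map_target' u hu := by
    rw [dif_pos hu]
    change (a⁻¹ * (a * _) : hyperquadricJ α β).1 0 ≠ 0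
    rw [inv_mul_cancel_left]
    exact hu.1
  left_inv' x hx := by
    have hx' : gbProj (a⁻¹ * x : hyperquadricJ α β) ∈ gbChartTarget α β := by
      refine ⟨hx, ?_⟩
      rw [gbGraph_gbProj (a⁻¹ * x : hyperquadricJ α β).2 hx]
      exact (a⁻¹ * x : hyperquadricJ α β).2.2
    rw [dif_pos hx']
    have : (⟨gbGraph β (gbProj (a⁻¹ * x : hyperquadricJ α β)), gbGraph_mem hx'⟩ :
        hyperquadricJ α β) = a⁻¹ * x :=
      Subtype.ext (gbGraph_gbProj (a⁻¹ * x : hyperquadricJ α β).2 hx)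
    rw [this, mul_inv_cancel_left]
  right_inv' u hu := by
    rw [dif_pos hu, inv_mul_cancel_left]
    exact gbProj_gbGraph β u
  open_source := by
    have h : Continuous fun x : hyperquadricJ α β => (a⁻¹ * x : hyperquadricJ α β).1 0 :=
      (continuous_apply 0).comp
        ((contDiff_gbMul_left α β (a⁻¹ : hyperquadricJ α β)).continuous.comp continuous_subtype_val)
    exact isOpen_ne_fun h continuous_const
  open_target := isOpen_gbChartTarget α β
  continuousOn_toFun :=
    (contDiff_gbProj.continuous.comp ((contDiff_gbMul_left α β
      (a⁻¹ : hyperquadricJ α β)).continuous.comp continuous_subtype_val)).continuousOn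
  continuousOn_invFun := by
    rw [Topology.IsInducing.subtypeVal.continuousOn_iff]
    have h : ContinuousOn (fun u => gbMul α β a (gbGraph β u)) (gbChartTarget α β) :=
      (contDiff_gbMul_left α β a).continuous.comp_continuousOn
        ((contDiffOn_gbGraph β).continuousOn.mono fun u hu => hu.1)
    refine h.congr fun u hu => ?_
    simp only [Function.comp_apply, dif_pos hu]
    rfl

/-- The three-dimensional manifold structure of the hyperquadric, for the topology induced
from `ℝ⁴`. -/
noncomputable instance hyperquadricJChartedSpace (α β : ℝ) :
    ChartedSpace (Fin 3 → ℝ) (hyperquadricJ α β) where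
  atlas := Set.range (gbChart α β)
  chartAt a := gbChart α β a
  mem_chart_source a := by
    change (a⁻¹ * a : hyperquadricJ α β).1 0 ≠ 0
    rw [inv_mul_cancel, hyperquadricJ_coe_one]
    simp [gbOne]
  chart_mem_atlas a := ⟨a, rfl⟩

instance hyperquadricJ_isManifold (α β : ℝ) :
    IsManifold 𝓘(ℝ, Fin 3 → ℝ) ∞ (hyperquadricJ α β) := by
  apply isManifold_of_contDiffOn
  rintro _ _ ⟨a, rfl⟩ ⟨b, rfl⟩
  have h : ContDiffOn ℝ ∞ (fun u => gbProj (gbMul α β (b⁻¹ : hyperquadricJ α β)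
      (gbMul α β a (gbGraph β u)))) (gbChartTarget α β) :=
    contDiff_gbProj.comp_contDiffOn ((contDiff_gbMul_left α β _).comp_contDiffOn
      ((contDiff_gbMul_left α β _).comp_contDiffOn
        ((contDiffOn_gbGraph β).mono fun u hu => hu.1)))
  refine (h.mono ?_).congr ?_
  · rintro u ⟨hu, -⟩
    exact hu.1
  · rintro u ⟨hu, -⟩
    have hu' : u ∈ gbChartTarget α β := hu.1
    have hs : (gbChart α β a).symm u = a * ⟨gbGraph β u, gbGraph_mem hu'⟩ := dif_pos hu'
    change gbProj (b⁻¹ * (gbChart α β a).symm u : hyperquadricJ α β) = _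
    rw [hs]
    rfl

/-- The space underlying the Lie algebra of a real Lie group `G`: the smooth vector fields `X`
on `G` with `d(L_g) X = X` for all left translations `L_g`. -/
def leftInvariantVectorFields {E H : Type*} [NormedAddCommGroup E] [NormedSpace ℝ E]
    [TopologicalSpace H] (I : ModelWithCorners ℝ E H) (G : Type*) [TopologicalSpace G]
    [ChartedSpace H G] [Group G] [IsManifold I 1 G] :
    Submodule ℝ (∀ x : G, TangentSpace I x) where
  carrier := {X | ContMDiff I I.tangent ∞ (fun x => (⟨x, X x⟩ : TangentBundle I G)) ∧
    ∀ g x : G, mfderiv I I (fun y : G => g * y) x (X x) = X (g * x)}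
  add_mem' := by
    rintro X Y ⟨hX, hX'⟩ ⟨hY, hY'⟩
    exact ⟨hX.add_section hY, fun g x => by
      rw [Pi.add_apply, Pi.add_apply, map_add, hX', hY']⟩
  zero_mem' := ⟨Bundle.contMDiff_zeroSection ℝ _, fun g x => by simp⟩
  smul_mem' := by
    rintro c X ⟨hX, hX'⟩
    exact ⟨hX.const_smul_section, fun g x => by
      rw [Pi.smul_apply, Pi.smul_apply, map_smul, hX']⟩

/-! The chart at `a` is the left translate by `a` of one chart at the identity, in which the quadric
is the graph x₂ = -β x₃ x₄ / x₁. So every point has the coordinates (1, 0, 0) in its own chart, and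
the inclusion ι into ℝ⁴ reads there as the linear map "multiply by x" after `gbGraph`. The graph is
flat in x₂ at (1, 0, 0), hence dι at x sends v to x · (v₀, 0, v₁, v₂) (`mfderiv_hyperquadricJ_coe`),
which is injective.

Fields with constant coordinates v, each taken in the chart at the point itself, are therefore
left-invariant: dι turns this into associativity of the product. Conversely the value at 1
determines a left-invariant field, so these are all of them, and the standard basis of ℝ³ gives x ·
1, x · j and x · ij.

The group operations are smooth because they are restrictions of smooth maps of ℝ⁴, and smoothness
into the hyperquadric can be tested in ℝ⁴ (`contMDiff_of_hyperquadricJ_coe`). -/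

open Bundle in
/-- Left translates of a vector at the identity of a smooth Lie group form a smooth field. -/
theorem contMDiff_infty_mulInvariantVectorField {E H G : Type*} [NormedAddCommGroup E]
    [NormedSpace ℝ E] [TopologicalSpace H] {I : ModelWithCorners ℝ E H} [TopologicalSpace G]
    [ChartedSpace H G] [Group G] [LieGroup I ∞ G] [IsManifold I 1 G] (v : GroupLieAlgebra I G) :
    ContMDiff I I.tangent ∞
      (fun g : G => (⟨g, mulInvariantVectorField v g⟩ : TangentBundle I G)) := by
  have : IsManifold I ∞ G := LieGroup.toContMDiffMul.toIsManifold
  -- `∞ + 1` reduces to `∞`: passing to the tangent map costs no smoothness.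
  have : IsManifold I (∞ + 1) G := this
  -- The field at g is the differential of multiplication at (g, 1) applied to (0, v), a composite
  -- of smooth maps.
  let fg : G → TangentBundle I G := fun g ↦ TotalSpace.mk' E g 0
  have sfg : ContMDiff I I.tangent ∞ fg := contMDiff_zeroSection _ _
  let fv : G → TangentBundle I G := fun _ ↦ TotalSpace.mk' E 1 v
  have sfv : ContMDiff I I.tangent ∞ fv := contMDiff_const
  let F₂ : (TangentBundle I G × TangentBundle I G) → TangentBundle (I.prod I) (G × G) :=
    (equivTangentBundleProd I G I G).symm
  have S₂ : ContMDiff (I.tangent.prod I.tangent) (I.prod I).tangent ∞ F₂ :=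
    contMDiff_equivTangentBundleProd_symm
  let F₃ : TangentBundle (I.prod I) (G × G) → TangentBundle I G :=
    tangentMap (I.prod I) I (fun p : G × G ↦ p.1 * p.2)
  have S₃ : ContMDiff (I.prod I).tangent I.tangent ∞ F₃ :=
    (contMDiff_mul I ∞).contMDiff_tangentMap (m := ∞) (n := ∞) le_rfl
  convert! (S₃.comp S₂).comp (sfg.prodMk sfv) with g
  · simp [F₂, F₃, fg, fv]
  · simp only [Function.comp_apply, tangentMap, F₃, F₂, fg, fv]
    rw [mfderiv_prod_eq_add_apply ((contMDiff_mul I ∞).mdifferentiableAt (by simp))]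
    change _ = mfderiv I I (fun z : G => z * 1) g 0 + mfderiv I I (fun z : G => g * z) 1 v
    rw [map_zero, zero_add]
    rfl

/-! ### Linear algebra of the product on ℝ⁴ -/

theorem gbMul_assoc (α β : ℝ) (x y z : Fin 4 → ℝ) :
    gbMul α β (gbMul α β x y) z = gbMul α β x (gbMul α β y z) := by
  ext k
  fin_cases k <;> simp only [gbMul, Matrix.cons_val, Fin.reduceFinMk, Fin.zero_eta, Fin.mk_one] <;>
    ring

theorem gbOne_gbMul (α β : ℝ) (x : Fin 4 → ℝ) : gbMul α β gbOne x = x := by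
  ext k
  fin_cases k <;> simp [gbMul, gbOne]

/-- Left multiplication as a linear map. -/
def gbMulLinear (α β : ℝ) (a : Fin 4 → ℝ) : (Fin 4 → ℝ) →ₗ[ℝ] Fin 4 → ℝ where
  toFun := gbMul α β a
  map_add' x y := by
    ext k
    fin_cases k <;> simp [gbMul] <;> ring
  map_smul' c x := by
    ext k
    fin_cases k <;> simp [gbMul] <;> ring

theorem gbMul_injective {α β : ℝ} (a : hyperquadricJ α β) :
    Function.Injective (gbMul α β (a : Fin 4 → ℝ)) := by
  intro x y h
  have := congrArg (gbMul α β (a⁻¹ : hyperquadricJ α β)) h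
  rwa [← gbMul_assoc, ← gbMul_assoc, ← hyperquadricJ_coe_mul, inv_mul_cancel,
    hyperquadricJ_coe_one, gbOne_gbMul, gbOne_gbMul] at this

theorem hasFDerivAt_gbMul (α β : ℝ) (a x : Fin 4 → ℝ) :
    HasFDerivAt (gbMul α β a) (gbMulLinear α β a).toContinuousLinearMap x :=
  (gbMulLinear α β a).toContinuousLinearMap.hasFDerivAt

/-! ### The inclusion in charts, and smoothness of the group operations -/

/-- The derivative of `gbGraph` at the coordinates of the identity. -/
def gbTangent : (Fin 3 → ℝ) →ₗ[ℝ] Fin 4 → ℝ where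
  toFun v := ![v 0, 0, v 1, v 2]
  map_add' x y := by
    ext k
    fin_cases k <;> simp
  map_smul' c x := by
    ext k
    fin_cases k <;> simp

theorem gbTangent_injective : Function.Injective gbTangent := by
  intro x y h
  ext k
  fin_cases k
  · exact congrFun h 0
  · exact congrFun h 2
  · exact congrFun h 3

theorem hasFDerivAt_gbGraph_one (β : ℝ) :
    HasFDerivAt (gbGraph β) gbTangent.toContinuousLinearMap (gbProj gbOne) := by
  have hd (i : Fin 3) : HasFDerivAt (fun u : Fin 3 → ℝ => u i)
      (ContinuousLinearMap.proj (R := ℝ) (φ := fun _ : Fin 3 => ℝ) i) (gbProj gbOne) :=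
    hasFDerivAt_apply i _
  rw [hasFDerivAt_pi']
  intro k
  fin_cases k
  · exact hd 0
  -- The product u₁ u₂ vanishes to second order at (1, 0, 0), so this component has derivative zero.
  · have h0 : (gbProj gbOne) 0 ≠ 0 := by simp [gbProj, gbOne]
    have h := (((hd 1).mul (hd 2)).const_mul β).neg.mul
      ((hasDerivAt_inv h0).comp_hasFDerivAt (gbProj gbOne) (hd 0))
    refine HasFDerivAt.congr_fderiv (h.congr_of_eventuallyEq ?_) ?_
    · refine Filter.Eventually.of_forall fun u => ?_
      simp [gbGraph, div_eq_mul_inv, mul_assoc]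
    · ext v
      simp [gbTangent, gbProj, gbOne]
  · exact hd 1
  · exact hd 2

theorem hyperquadricJ_extChartAt_apply {α β : ℝ} (a x : hyperquadricJ α β) :
    extChartAt 𝓘(ℝ, Fin 3 → ℝ) a x = gbProj (a⁻¹ * x : hyperquadricJ α β) := rfl

theorem hyperquadricJ_extChartAt_self {α β : ℝ} (a : hyperquadricJ α β) :
    extChartAt 𝓘(ℝ, Fin 3 → ℝ) a a = gbProj gbOne := by
  rw [hyperquadricJ_extChartAt_apply, inv_mul_cancel, hyperquadricJ_coe_one]

theorem coe_eq_gbMul_gbGraph {α β : ℝ} {a x : hyperquadricJ α β}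
    (hx : x ∈ (chartAt (Fin 3 → ℝ) a).source) :
    (x : Fin 4 → ℝ) = gbMul α β a (gbGraph β (extChartAt 𝓘(ℝ, Fin 3 → ℝ) a x)) := by
  rw [hyperquadricJ_extChartAt_apply, gbGraph_gbProj (a⁻¹ * x : hyperquadricJ α β).2 hx,
    ← hyperquadricJ_coe_mul, mul_inv_cancel_left]

theorem contMDiff_hyperquadricJ_coe (α β : ℝ) :
    ContMDiff 𝓘(ℝ, Fin 3 → ℝ) 𝓘(ℝ, Fin 4 → ℝ) ∞
      (Subtype.val : hyperquadricJ α β → Fin 4 → ℝ) := by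
  intro a
  have h0 : (extChartAt 𝓘(ℝ, Fin 3 → ℝ) a a) 0 ≠ 0 := by
    rw [hyperquadricJ_extChartAt_self]
    simp [gbProj, gbOne]
  have ho : IsOpen {u : Fin 3 → ℝ | u 0 ≠ 0} := isOpen_ne_fun (by fun_prop) (by fun_prop)
  have h1 : ContDiffAt ℝ ∞ (gbMul α β a ∘ gbGraph β) (extChartAt 𝓘(ℝ, Fin 3 → ℝ) a a) :=
    (contDiff_gbMul_left α β a).contDiffAt.comp _
      ((contDiffOn_gbGraph β).contDiffAt (ho.mem_nhds h0))
  refine (h1.contMDiffAt.comp a contMDiffAt_extChartAt).congr_of_eventuallyEq ?_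
  filter_upwards [chart_source_mem_nhds (Fin 3 → ℝ) a] with x hx
  exact coe_eq_gbMul_gbGraph hx

/-- A map into the hyperquadric is smooth if it is smooth as a map into `ℝ⁴`. -/
theorem contMDiff_of_hyperquadricJ_coe {α β : ℝ} {E H N : Type*} [NormedAddCommGroup E]
    [NormedSpace ℝ E] [TopologicalSpace H] {I : ModelWithCorners ℝ E H} [TopologicalSpace N]
    [ChartedSpace H N] {f : N → hyperquadricJ α β}
    (hf : ContMDiff I 𝓘(ℝ, Fin 4 → ℝ) ∞ fun y => (f y : Fin 4 → ℝ)) :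
    ContMDiff I 𝓘(ℝ, Fin 3 → ℝ) ∞ f := by
  intro y
  rw [contMDiffAt_iff_target]
  refine ⟨(continuous_induced_rng.2 hf.continuous).continuousAt, ?_⟩
  -- The chart at `f y` is the restriction of a map smooth on all of ℝ⁴.
  exact ((contDiff_gbProj.comp (contDiff_gbMul_left α β
    ((f y)⁻¹ : hyperquadricJ α β))).contMDiff.comp hf) y

theorem contDiff_gbMul (α β : ℝ) :
    ContDiff ℝ ∞ fun p : (Fin 4 → ℝ) × (Fin 4 → ℝ) => gbMul α β p.1 p.2 := by
  rw [contDiff_pi]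
  intro k
  fin_cases k <;> simp only [gbMul, Matrix.cons_val, Fin.reduceFinMk, Fin.zero_eta, Fin.mk_one] <;>
    fun_prop

theorem contDiffOn_gbInv (α β : ℝ) :
    ContDiffOn ℝ ∞ (fun x => (gbMetricJ α β x)⁻¹ • gbConjJ x) {x | gbMetricJ α β x ≠ 0} := by
  have h1 : ContDiff ℝ ∞ (gbMetricJ α β) := by unfold gbMetricJ; fun_prop
  have h2 : ContDiff ℝ ∞ gbConjJ := by
    rw [contDiff_pi]
    intro k
    fin_cases k <;> simp only [gbConjJ, Matrix.cons_val, Fin.reduceFinMk, Fin.zero_eta,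
      Fin.mk_one] <;> fun_prop
  exact (h1.contDiffOn.inv fun x hx => hx).smul h2.contDiffOn

theorem hyperquadricJ_lieGroup (α β : ℝ) :
    LieGroup 𝓘(ℝ, Fin 3 → ℝ) ∞ (hyperquadricJ α β) where
  contMDiff_mul := contMDiff_of_hyperquadricJ_coe <|
    (contDiff_gbMul α β).contMDiff.comp
      (((contMDiff_hyperquadricJ_coe α β).comp contMDiff_fst).prodMk_space
        ((contMDiff_hyperquadricJ_coe α β).comp contMDiff_snd))
  contMDiff_inv := contMDiff_of_hyperquadricJ_coe <|
    (contDiffOn_gbInv α β).contMDiffOn.comp_contMDiff (contMDiff_hyperquadricJ_coe α β)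
      fun x => x.2.2

/-! ### The differential of the inclusion and left-invariant fields -/

/-- The differential of the inclusion of the hyperquadric in `ℝ⁴`. -/
theorem mfderiv_hyperquadricJ_coe {α β : ℝ} (x : hyperquadricJ α β)
    (v : TangentSpace 𝓘(ℝ, Fin 3 → ℝ) x) :
    (mfderiv 𝓘(ℝ, Fin 3 → ℝ) 𝓘(ℝ, Fin 4 → ℝ)
      (Subtype.val : hyperquadricJ α β → Fin 4 → ℝ) x v : Fin 4 → ℝ) =
      gbMul α β x (gbTangent v) := by
  have h : HasFDerivAt (gbMul α β x ∘ gbGraph β)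
      ((gbMulLinear α β x).toContinuousLinearMap.comp gbTangent.toContinuousLinearMap)
      (extChartAt 𝓘(ℝ, Fin 3 → ℝ) x x) := by
    rw [hyperquadricJ_extChartAt_self]
    exact (hasFDerivAt_gbMul α β x _).comp _ (hasFDerivAt_gbGraph_one β)
  have he : writtenInExtChartAt 𝓘(ℝ, Fin 3 → ℝ) 𝓘(ℝ, Fin 4 → ℝ) x
      (Subtype.val : hyperquadricJ α β → Fin 4 → ℝ) =ᶠ[𝓝 (extChartAt 𝓘(ℝ, Fin 3 → ℝ) x x)]
      gbMul α β x ∘ gbGraph β := by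
    filter_upwards [extChartAt_target_mem_nhds (I := 𝓘(ℝ, Fin 3 → ℝ)) x] with u hu
    have hs := (extChartAt 𝓘(ℝ, Fin 3 → ℝ) x).map_target hu
    rw [extChartAt_source] at hs
    have := coe_eq_gbMul_gbGraph hs
    rw [(extChartAt 𝓘(ℝ, Fin 3 → ℝ) x).right_inv hu] at this
    exact this
  have hd : HasMFDerivAt 𝓘(ℝ, Fin 3 → ℝ) 𝓘(ℝ, Fin 4 → ℝ)
      (Subtype.val : hyperquadricJ α β → Fin 4 → ℝ) x
      ((gbMulLinear α β x).toContinuousLinearMap.comp gbTangent.toContinuousLinearMap) :=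
    ⟨continuous_subtype_val.continuousAt, (h.congr_of_eventuallyEq he).hasFDerivWithinAt⟩
  exact DFunLike.congr_fun hd.mfderiv v

theorem mfderiv_hyperquadricJ_coe_injective {α β : ℝ} (x : hyperquadricJ α β) :
    Function.Injective (mfderiv 𝓘(ℝ, Fin 3 → ℝ) 𝓘(ℝ, Fin 4 → ℝ)
      (Subtype.val : hyperquadricJ α β → Fin 4 → ℝ) x) := by
  intro v w h
  refine gbTangent_injective (gbMul_injective x ?_)
  rw [← mfderiv_hyperquadricJ_coe, ← mfderiv_hyperquadricJ_coe]
  exact h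

/-- The vector field whose value at every point `x` has the coordinates `v` in the chart at `x`. -/
def hyperquadricJField (α β : ℝ) :
    (Fin 3 → ℝ) →ₗ[ℝ] ∀ x : hyperquadricJ α β, TangentSpace 𝓘(ℝ, Fin 3 → ℝ) x where
  toFun v _ := v
  map_add' _ _ := rfl
  map_smul' _ _ := rfl

theorem mfderiv_mul_left_hyperquadricJField {α β : ℝ} (v : Fin 3 → ℝ) (g x : hyperquadricJ α β) :
    mfderiv 𝓘(ℝ, Fin 3 → ℝ) 𝓘(ℝ, Fin 3 → ℝ) (fun y => g * y) x (hyperquadricJField α β v x) =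
      hyperquadricJField α β v (g * x) := by
  have := hyperquadricJ_lieGroup α β
  have hι (y : hyperquadricJ α β) :=
    (contMDiff_hyperquadricJ_coe α β).mdifferentiableAt (x := y) (by simp)
  have hL : MDifferentiableAt 𝓘(ℝ, Fin 3 → ℝ) 𝓘(ℝ, Fin 3 → ℝ) (fun y => g * y) x :=
    (contMDiff_mul_left (I := 𝓘(ℝ, Fin 3 → ℝ)) (n := ∞)).mdifferentiableAt (by simp)
  have hM : MDifferentiableAt 𝓘(ℝ, Fin 4 → ℝ) 𝓘(ℝ, Fin 4 → ℝ) (gbMul α β g) (x : Fin 4 → ℝ) :=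
    (hasFDerivAt_gbMul α β g x).differentiableAt.mdifferentiableAt
  -- Differentiate ι ∘ L_g = (g ·) ∘ ι at x and compare in ℝ⁴, where dι is injective.
  apply mfderiv_hyperquadricJ_coe_injective (g * x)
  have h1 := mfderiv_comp x (hι (g * x)) hL
  have h2 := mfderiv_comp x hM (hι x)
  have h3 := DFunLike.congr_fun (h1.symm.trans h2) (hyperquadricJField α β v x)
  refine h3.trans ?_
  change mfderiv 𝓘(ℝ, Fin 4 → ℝ) 𝓘(ℝ, Fin 4 → ℝ) (gbMul α β g) (x : Fin 4 → ℝ)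
    (mfderiv 𝓘(ℝ, Fin 3 → ℝ) 𝓘(ℝ, Fin 4 → ℝ) Subtype.val x (hyperquadricJField α β v x)) = _
  rw [mfderiv_eq_fderiv, (hasFDerivAt_gbMul α β g x).fderiv]
  change gbMul α β g _ = _
  refine (congrArg _ (mfderiv_hyperquadricJ_coe x _)).trans ?_
  refine Eq.trans ?_ (mfderiv_hyperquadricJ_coe (g * x) _).symm
  rw [hyperquadricJ_coe_mul, gbMul_assoc]
  rfl

theorem eq_hyperquadricJField_of_leftInvariant {α β : ℝ}
    {X : ∀ x : hyperquadricJ α β, TangentSpace 𝓘(ℝ, Fin 3 → ℝ) x}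
    (hX : ∀ g x : hyperquadricJ α β,
      mfderiv 𝓘(ℝ, Fin 3 → ℝ) 𝓘(ℝ, Fin 3 → ℝ) (fun y => g * y) x (X x) = X (g * x)) :
    X = hyperquadricJField α β (X 1) := by
  funext g
  have h1 := hX g 1
  have h2 := mfderiv_mul_left_hyperquadricJField (X 1) g 1
  rw [mul_one] at h1 h2
  exact h1.symm.trans h2

/-- Invariance alone forces constant coordinates; smoothness then follows, since such a field is the
left translate of its value at 1. -/
theorem leftInvariantVectorFields_hyperquadricJ (α β : ℝ) :
    leftInvariantVectorFields 𝓘(ℝ, Fin 3 → ℝ) (hyperquadricJ α β) =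
      LinearMap.range (hyperquadricJField α β) := by
  ext X
  constructor
  · rintro ⟨-, hX⟩
    exact ⟨X 1, (eq_hyperquadricJField_of_leftInvariant hX).symm⟩
  · rintro ⟨v, rfl⟩
    refine ⟨?_, mfderiv_mul_left_hyperquadricJField v⟩
    have := hyperquadricJ_lieGroup α β
    convert contMDiff_infty_mulInvariantVectorField (I := 𝓘(ℝ, Fin 3 → ℝ))
      (G := hyperquadricJ α β) v using 3 with g
    have h := mfderiv_mul_left_hyperquadricJField v g 1
    rw [mul_one] at h
    exact h.symm

theorem span_standard_basis_three :
    (⊤ : Submodule ℝ (Fin 3 → ℝ)) = Submodule.span ℝ {![1, 0, 0], ![0, 1, 0], ![0, 0, 1]} := by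
  refine (eq_top_iff.2 fun v _ => ?_).symm
  rw [Submodule.mem_span_triple]
  refine ⟨v 0, v 1, v 2, ?_⟩
  ext k
  fin_cases k <;> simp

/-- For all real `α, β` the hyperquadric is a Lie group, embedded in `ℝ⁴`, and its Lie algebra
is spanned by the left-invariant vector fields whose components in `ℝ⁴` are as displayed. -/
theorem mainTheorem5 (α β : ℝ) :
    LieGroup 𝓘(ℝ, Fin 3 → ℝ) ∞ (hyperquadricJ α β) ∧
    ContMDiff 𝓘(ℝ, Fin 3 → ℝ) 𝓘(ℝ, Fin 4 → ℝ) ∞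
      (Subtype.val : hyperquadricJ α β → Fin 4 → ℝ) ∧
    (∀ x : hyperquadricJ α β, Function.Injective
      (mfderiv 𝓘(ℝ, Fin 3 → ℝ) 𝓘(ℝ, Fin 4 → ℝ)
        (Subtype.val : hyperquadricJ α β → Fin 4 → ℝ) x)) ∧
    ∃ X₁ X₃ X₄ : ∀ x : hyperquadricJ α β, TangentSpace 𝓘(ℝ, Fin 3 → ℝ) x,
      (∀ x : hyperquadricJ α β,
        (mfderiv 𝓘(ℝ, Fin 3 → ℝ) 𝓘(ℝ, Fin 4 → ℝ)
            (Subtype.val : hyperquadricJ α β → Fin 4 → ℝ) x (X₁ x) : Fin 4 → ℝ) =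
          ![x.1 0, x.1 1, x.1 2, x.1 3]) ∧
      (∀ x : hyperquadricJ α β,
        (mfderiv 𝓘(ℝ, Fin 3 → ℝ) 𝓘(ℝ, Fin 4 → ℝ)
            (Subtype.val : hyperquadricJ α β → Fin 4 → ℝ) x (X₃ x) : Fin 4 → ℝ) =
          gbMul α β x gbJ ∧
        gbMul α β x gbJ = ![-β * x.1 2, -β * x.1 3, x.1 0, x.1 1]) ∧
      (∀ x : hyperquadricJ α β,
        (mfderiv 𝓘(ℝ, Fin 3 → ℝ) 𝓘(ℝ, Fin 4 → ℝ)
            (Subtype.val : hyperquadricJ α β → Fin 4 → ℝ) x (X₄ x) : Fin 4 → ℝ) =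
          gbMul α β x gbIJ ∧
        gbMul α β x gbIJ = ![α * β * x.1 3, -β * x.1 2, -α * x.1 1, x.1 0]) ∧
      leftInvariantVectorFields 𝓘(ℝ, Fin 3 → ℝ) (hyperquadricJ α β) =
        Submodule.span ℝ {X₁, X₃, X₄} ∧
      (⊤ : Submodule ℝ (GroupLieAlgebra 𝓘(ℝ, Fin 3 → ℝ) (hyperquadricJ α β))) =
        Submodule.span ℝ {X₁ 1, X₃ 1, X₄ 1} := by
  -- The tangent space at 1 unfolds to ℝ³ and the three fields take the standard basis vectors as
  -- values, which settles the last claim.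
  refine ⟨hyperquadricJ_lieGroup α β, contMDiff_hyperquadricJ_coe α β,
    mfderiv_hyperquadricJ_coe_injective, hyperquadricJField α β ![1, 0, 0],
    hyperquadricJField α β ![0, 1, 0], hyperquadricJField α β ![0, 0, 1],
    fun x => ?_, fun x => ⟨?_, ?_⟩, fun x => ⟨?_, ?_⟩, ?_, span_standard_basis_three⟩
  · refine (mfderiv_hyperquadricJ_coe x _).trans ?_
    change gbMul α β x ![1, 0, 0, 0] = _
    simp [gbMul]
  · exact mfderiv_hyperquadricJ_coe x _
  · simp [gbMul, gbJ]
  · exact mfderiv_hyperquadricJ_coe x _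
  · simp [gbMul, gbIJ]
  · rw [leftInvariantVectorFields_hyperquadricJ, LinearMap.range_eq_map,
      span_standard_basis_three, Submodule.map_span]
    simp only [Set.image_insert_eq, Set.image_singleton]
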